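/- Let $V$ be a finite set of $n$ vertices, each carrying one color from a set $\chi$ of colors. A clustering of $V$ is a partition of $V$ into clusters. For $c\in\chi$ and $S\subseteq V$ let $c(S)$ be the number of vertices of color $c$ in $S$. A clustering $\mathcal F$ is fair if in each of its clusters $F$ the colors stand in the same ratio as in $V$, i.e. $c(F)\,c'(V)=c'(F)\,c(V)$ for all $c,c'\in\chi$. For clusterings $\mathcal C,\mathcal D$ let $\mathrm{dist}(\mathcal C,\mathcal D)$ be the number of unordered pairs of vertices that lie in a common cluster in exactly one of $\mathcal C$ and $\mathcal D$. A fair clustering $\mathcal F$ is $\alpha$-close to $\mathcal C$ if $\mathrm{dist}(\mathcal C,\mathcal F)\le\alpha\,\mathrm{dist}(\mathcal C,\mathcal F^*)$, where $\mathcal F^*$ is a fair clustering at minimum distance from $\mathcal C$. Theorem. There are a deterministic algorithm, running in time polynomial in $n$, and an absolute constant $K>0$ such that the following holds. Given any finite set $\chi$ of colors with $|\chi|>2$, any finite vertex set $V$ colored from $\chi$ such that all color classes have the same size, and any clustering $\mathcal C$ of $V$, the algorithm computes a fair clustering of $V$ that is $\left(K\,|\chi|^{1.6}\,(\log_2|\chi|)^{2.81}\right)$-close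 to $\mathcal C$. Moreover, whenever $|\chi|$ is a power of two, the clustering computed by the same algorithm is $\left(K\,|\chi|^{1.6}\right)$-close to $\mathcal C$; indeed, it is then $3^{\log_2|\chi|}$-close to $\mathcal C$. (Running time is the number of steps on a random access machine with unit-cost addition and truncated subtraction of natural numbers and without multiplication; the input consists of $n$, $|\chi|$, the array of the colors of the vertices, and an array of cluster labels in $\{0,\dots,n-1\}$, equal labels meaning the same cluster. The output is again an array of labels.) -/

import Mathlib

namespace FairClustering

/-! ### Clusterings

A clustering of `V` is a partition of `V`, given as the equivalence relation "lies in the same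
cluster"; its clusters are the equivalence classes `C.classes`. -/

section Clusterings

variable {V χ : Type*}

/-- The number `c(S)` of vertices of color `c` in the vertex set `S`, where vertex `v` has
color `σ v`. -/
noncomputable def colorCount (σ : V → χ) (c : χ) (S : Set V) : ℕ :=
  {v | v ∈ S ∧ σ v = c}.ncard

/-- All color classes have the same size. -/
def EqualColorClasses (σ : V → χ) : Prop :=
  ∀ c c' : χ, colorCount σ c Set.univ = colorCount σ c' Set.univ

/-- A clustering is fair if in every cluster the colors stand in the same ratio as in `V`.
The equality of ratios `c₁(F) : ⋯ : c_d(F) = c₁(V) : ⋯ : c_d(V)` is written without division. -/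
def IsFair (σ : V → χ) (𝓕 : Setoid V) : Prop :=
  ∀ F ∈ 𝓕.classes, ∀ c c' : χ,
    colorCount σ c F * colorCount σ c' Set.univ = colorCount σ c' F * colorCount σ c Set.univ

/-- The number of unordered pairs of vertices that are together in exactly one of the two
clusterings. -/
noncomputable def dist (C D : Setoid V) : ℕ :=
  {e : Sym2 V | ∃ u v, e = s(u, v) ∧ ((C u v ∧ ¬ D u v) ∨ (¬ C u v ∧ D u v))}.ncard

/-- `𝓕` is a fair clustering at minimum distance from `C` among all fair clusterings. -/
def IsClosestFair (σ : V → χ) (C 𝓕 : Setoid V) : Prop :=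
  IsFair σ 𝓕 ∧ ∀ 𝓕' : Setoid V, IsFair σ 𝓕' → dist C 𝓕 ≤ dist C 𝓕'

/-- `𝓕` is an `α`-close fair clustering to `C`. -/
def IsCloseFair (α : ℝ) (σ : V → χ) (C 𝓕 : Setoid V) : Prop :=
  IsFair σ 𝓕 ∧
    ∃ 𝓕opt : Setoid V, IsClosestFair σ C 𝓕opt ∧ (dist C 𝓕 : ℝ) ≤ α * (dist C 𝓕opt : ℝ)

end Clusterings

/-! ### The machine model

A structured random access machine: registers and random access arrays holding natural numbers,
with addition and truncated subtraction as the only arithmetic. Every operation costs one step.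
As there is no multiplication, each step lengthens the largest number stored by at most one bit,
so polynomial time on this machine is polynomial time on a Turing machine. -/

/-- Contents of the registers and of the arrays. -/
structure Store where
  reg : ℕ → ℕ
  arr : ℕ → ℕ → ℕ

/-- Expressions: a constant, a register, the entry of array `a` at a computed index, sum,
truncated difference. -/
inductive Expr where
  | const (k : ℕ)
  | reg (x : ℕ)
  | entry (a : ℕ) (i : Expr)
  | add (e₁ e₂ : Expr)
  | sub (e₁ e₂ : Expr)

/-- The value of an expression. -/
def Expr.eval (s : Store) : Expr → ℕ
  | .const k => k
  | .reg x => s.reg x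
  | .entry a i => s.arr a (i.eval s)
  | .add e₁ e₂ => e₁.eval s + e₂.eval s
  | .sub e₁ e₂ => e₁.eval s - e₂.eval s

/-- The number of steps needed to evaluate an expression: one for each of its nodes. -/
def Expr.cost : Expr → ℕ
  | .const _ => 1
  | .reg _ => 1
  | .entry _ i => i.cost + 1
  | .add e₁ e₂ => e₁.cost + e₂.cost + 1
  | .sub e₁ e₂ => e₁.cost + e₂.cost + 1

/-- Programs. `ite e p q` runs `p` if `e ≠ 0` and `q` if `e = 0`; `loop e p` repeats `p` as long
as `e ≠ 0`. -/
inductive Prog where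
  | skip
  | assign (x : ℕ) (e : Expr)
  | write (a : ℕ) (i e : Expr)
  | seq (p q : Prog)
  | ite (e : Expr) (p q : Prog)
  | loop (e : Expr) (p : Prog)

/-- The store after `reg x := k`. -/
def Store.setReg (s : Store) (x k : ℕ) : Store :=
  { s with reg := Function.update s.reg x k }

/-- The store after `arr a [i] := k`. -/
def Store.setArr (s : Store) (a i k : ℕ) : Store :=
  { s with arr := Function.update s.arr a (Function.update (s.arr a) i k) }

/-- `Exec p s t s'`: program `p`, started in store `s`, halts after exactly `t` steps in
store `s'`. -/
inductive Exec : Prog → Store → ℕ → Store → Prop where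
  | skip (s : Store) : Exec .skip s 1 s
  | assign (x : ℕ) (e : Expr) (s : Store) :
      Exec (.assign x e) s (e.cost + 1) (s.setReg x (e.eval s))
  | write (a : ℕ) (i e : Expr) (s : Store) :
      Exec (.write a i e) s (i.cost + e.cost + 1) (s.setArr a (i.eval s) (e.eval s))
  | seq {p q : Prog} {s s₁ s₂ : Store} {t₁ t₂ : ℕ} :
      Exec p s t₁ s₁ → Exec q s₁ t₂ s₂ → Exec (.seq p q) s (t₁ + t₂) s₂
  | iteTrue {e : Expr} {p q : Prog} {s s₁ : Store} {t : ℕ} :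
      e.eval s ≠ 0 → Exec p s t s₁ → Exec (.ite e p q) s (e.cost + 1 + t) s₁
  | iteFalse {e : Expr} {p q : Prog} {s s₁ : Store} {t : ℕ} :
      e.eval s = 0 → Exec q s t s₁ → Exec (.ite e p q) s (e.cost + 1 + t) s₁
  | loopDone {e : Expr} {p : Prog} {s : Store} :
      e.eval s = 0 → Exec (.loop e p) s (e.cost + 1) s
  | loopStep {e : Expr} {p : Prog} {s s₁ s₂ : Store} {t₁ t₂ : ℕ} :
      e.eval s ≠ 0 → Exec p s t₁ s₁ → Exec (.loop e p) s₁ t₂ s₂ →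
        Exec (.loop e p) s (e.cost + 1 + t₁ + t₂) s₂

/-- Programs are deterministic: the running time and the final store are unique. -/
theorem Exec.unique {p : Prog} {s s₁ s₂ : Store} {t₁ t₂ : ℕ}
    (h₁ : Exec p s t₁ s₁) (h₂ : Exec p s t₂ s₂) : t₁ = t₂ ∧ s₁ = s₂ := by
  induction h₁ generalizing t₂ s₂ with
  | skip s => cases h₂; exact ⟨rfl, rfl⟩
  | assign x e s => cases h₂; exact ⟨rfl, rfl⟩
  | write a i e s => cases h₂; exact ⟨rfl, rfl⟩
  | seq _ _ ih₁ ih₂ =>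
    cases h₂ with
    | seq hp hq =>
      obtain ⟨rfl, rfl⟩ := ih₁ hp
      obtain ⟨rfl, rfl⟩ := ih₂ hq
      exact ⟨rfl, rfl⟩
  | iteTrue he _ ih =>
    cases h₂ with
    | iteTrue _ hp =>
      obtain ⟨rfl, rfl⟩ := ih hp
      exact ⟨rfl, rfl⟩
    | iteFalse he' _ => exact absurd he' he
  | iteFalse he _ ih =>
    cases h₂ with
    | iteTrue he' _ => exact absurd he he'
    | iteFalse _ hp =>
      obtain ⟨rfl, rfl⟩ := ih hp
      exact ⟨rfl, rfl⟩
  | loopDone he =>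
    cases h₂ with
    | loopDone _ => exact ⟨rfl, rfl⟩
    | loopStep he' _ _ => exact absurd he he'
  | loopStep he _ _ ih₁ ih₂ =>
    cases h₂ with
    | loopDone he' => exact absurd he' he
    | loopStep _ hp hq =>
      obtain ⟨rfl, rfl⟩ := ih₁ hp
      obtain ⟨rfl, rfl⟩ := ih₂ hq
      exact ⟨rfl, rfl⟩

/-! ### Input and output

Vertices are `0, …, n - 1`, colors are `0, …, d - 1`. A clustering is written down as an array of
cluster labels: two vertices are in the same cluster iff their labels are equal. -/

/-- The initial store: register 0 holds the number `n` of vertices, register 1 the number `d` of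
colors, array 0 the colors of the vertices, array 1 their cluster labels; the rest is zero. -/
def inputStore {n d : ℕ} (σ : Fin n → Fin d) (label : Fin n → Fin n) : Store where
  reg x := if x = 0 then n else if x = 1 then d else 0
  arr a i :=
    if h : i < n then
      if a = 0 then (σ ⟨i, h⟩ : ℕ) else if a = 1 then (label ⟨i, h⟩ : ℕ) else 0
    else 0

/-- The clustering whose cluster labels are in array 2. -/
def outputClustering (n : ℕ) (s : Store) : Setoid (Fin n) :=
  Setoid.ker fun v : Fin n => s.arr 2 v

end FairClustering

/-! One clustering that is always $3(|\chi|-1)$-close proves every bound claimed, since $3(d-1)\le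
3d^{1.6}$ and $3(2^k-1)\le 3^k$ for $k\ge 2$.

Within each cluster, the vertices of each color are numbered, and vertices with equal numbers form a
slot. A slot has at most one vertex of each color. Slots with all colors stay in their cluster. All
other vertices are removed and matched by their rank among the removed vertices of their color. Kept
parts are balanced, so equal color classes leave equally many removed vertices of each color, and
the new clusters are rainbow (`isFair_fairLabel`).

Let a cluster $C$ have $a_c$ vertices of color $c$, with minimum $a_{c_0}$. It loses $\sum_c
(a_c-a_{c_0})$ vertices. If $F$ has $b$ vertices of each color, then $a_c-a_{c_0}\le
|a_c-b|+|a_{c_0}-b|\le |C\triangle F|$, so the loss is at most $(|\chi|-1)\,|C\triangle F|$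
(`card_removed_le`). Summing over vertices, with $F$ the cluster of the vertex in a fair clustering,
gives `dist_fairLabel_le`.

Levels, slot sizes and removed ranks all count the vertices $u$ satisfying a condition relative to
$v$, so three runs of one double loop compute the clustering in quadratic time. -/

namespace FairClustering

/-! ### Ranks, color counts and distances -/

section Combinatorics

open Finset

/-- The rank in a finite set: an injection onto an initial segment. -/
theorem card_filter_lt_injOn {V : Type*} [LinearOrder V] (S : Finset V) :
    Set.InjOn (fun v => #{u ∈ S | u < v}) S := by
  have key : ∀ v ∈ S, ∀ w, v < w → #{u ∈ S | u < v} < #{u ∈ S | u < w} := by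
    intro v hv w hvw
    refine card_lt_card ⟨fun u hu => ?_, fun h => ?_⟩
    · rw [mem_filter] at hu ⊢
      exact ⟨hu.1, hu.2.trans hvw⟩
    · have : v ∈ ({u ∈ S | u < v} : Finset V) := h (by simp [hv, hvw])
      simp at this
  intro v hv w hw h
  rcases lt_trichotomy v w with h' | h' | h'
  · exact absurd h (key v hv w h').ne
  · exact h'
  · exact absurd h (key w hw v h').ne'

theorem card_filter_lt_lt_card {V : Type*} [LinearOrder V] {S : Finset V} {v : V} (hv : v ∈ S) :
    #{u ∈ S | u < v} < #S :=
  card_lt_card ⟨filter_subset _ _, fun h => by simpa using h hv⟩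

theorem exists_card_filter_lt_eq {V : Type*} [LinearOrder V] {S : Finset V} {k : ℕ}
    (hk : k < #S) : ∃ v ∈ S, #{u ∈ S | u < v} = k := by
  have : S.image (fun v => #{u ∈ S | u < v}) = range #S := by
    refine eq_of_subset_of_card_le (fun i hi => ?_) ?_
    · obtain ⟨v, hv, rfl⟩ := mem_image.1 hi
      exact mem_range.2 (card_filter_lt_lt_card hv)
    · rw [card_range, card_image_of_injOn (card_filter_lt_injOn S)]
  have hk' := mem_range.2 hk
  rw [← this] at hk'
  simpa using hk'

/-- The answer depends on `S` only through its size; this makes equally large sets of removed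
vertices contribute equally to each new cluster. -/
theorem card_filter_card_filter_lt_eq {V : Type*} [LinearOrder V] (S : Finset V) (k : ℕ) :
    #{v ∈ S | #{u ∈ S | u < v} = k} = if k < #S then 1 else 0 := by
  split_ifs with h
  · obtain ⟨v, hv, rfl⟩ := exists_card_filter_lt_eq h
    rw [card_eq_one]
    refine ⟨v, ?_⟩
    ext w
    simp only [mem_filter, mem_singleton]
    exact ⟨fun hw => card_filter_lt_injOn S hw.1 hv hw.2, fun hw => by subst hw; exact ⟨hv, rfl⟩⟩
  · rw [card_eq_zero, filter_eq_empty_iff]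
    rintro v hv rfl
    exact h (card_filter_lt_lt_card hv)

theorem colorCount_eq_card {V χ : Type*} [Fintype V] [DecidableEq χ] (σ : V → χ) (c : χ) (S : Set V) [DecidablePred (· ∈ S)] :
    colorCount σ c S = #{v | v ∈ S ∧ σ v = c} := by
  rw [colorCount, ← Set.ncard_coe_finset]
  simp

/-- Handshake lemma for the graph of pairs on which the clusterings disagree. It reduces distances
to symmetric differences of the two clusters around each vertex. -/
theorem two_mul_dist {V : Type*} [Fintype V] (C D : Setoid V)
    [∀ v, DecidablePred fun u => ¬ (C v u ↔ D v u)] :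
    2 * dist C D = ∑ v, #{u | ¬ (C v u ↔ D v u)} := by
  classical
  let G : SimpleGraph V :=
    { Adj := fun u v => ¬ (C u v ↔ D u v)
      symm := ⟨fun u v h => by rwa [Setoid.comm' C (x := v), Setoid.comm' D (x := v)]⟩
      loopless := ⟨fun v h => h ⟨fun _ => D.refl v, fun _ => C.refl v⟩⟩ }
  have h1 : dist C D = #G.edgeFinset := by
    rw [dist, ← Set.ncard_coe_finset, SimpleGraph.coe_edgeFinset]
    congr 1
    ext e
    induction e with
    | _ u v =>
      simp only [Set.mem_ofPred_eq, SimpleGraph.mem_edgeSet]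
      constructor
      · rintro ⟨a, b, h, h'⟩
        have : G.Adj a b := by show ¬ _; tauto
        rw [← SimpleGraph.mem_edgeSet, h, SimpleGraph.mem_edgeSet]
        exact this
      · intro h
        have : ¬ (C u v ↔ D u v) := h
        exact ⟨u, v, rfl, by tauto⟩
  rw [h1, ← SimpleGraph.sum_degrees_eq_twice_card_edges]
  refine sum_congr rfl fun v _ => ?_
  rw [← SimpleGraph.card_neighborFinset_eq_degree]
  congr 1
  ext u
  simp [G]

theorem exists_balanced {V χ : Type*} [Fintype V] [DecidableEq χ] {σ : V → χ}
    (hσ : EqualColorClasses σ) {𝓕 : Setoid V} (h𝓕 : IsFair σ 𝓕) (v : V)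
    [DecidablePred (𝓕 v)] : ∃ b, ∀ c, #{u ∈ ({u | 𝓕 v u} : Finset V) | σ u = c} = b := by
  classical
  have hpos : colorCount σ (σ v) Set.univ ≠ 0 := by
    rw [colorCount_eq_card]
    exact (card_pos.2 ⟨v, by simp⟩).ne'
  refine ⟨colorCount σ (σ v) {u | 𝓕 u v}, fun c => ?_⟩
  have h := h𝓕 _ (𝓕.mem_classes v) c (σ v)
  rw [hσ c (σ v)] at h
  rw [← Nat.eq_of_mul_eq_mul_right (Nat.pos_of_ne_zero hpos) h, colorCount_eq_card, filter_filter]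
  congr 1
  ext u
  rw [mem_filter, mem_filter, Set.mem_ofPred_eq, Setoid.comm' 𝓕]

/-! ### Slots, removed vertices and the fair clustering -/

variable {V Λ χ : Type*} [Fintype V] [LinearOrder V] [DecidableEq Λ] [DecidableEq χ]
variable (σ : V → χ) (l : V → Λ)

/-- The number of earlier vertices of the same color in the same cluster. -/
def level (v : V) : ℕ := #{u | u < v ∧ l u = l v ∧ σ u = σ v}

/-- The number of vertices of the same level in the same cluster. -/
def slotSize (v : V) : ℕ := #{u | l u = l v ∧ level σ l u = level σ l v}

/-- The vertices whose slot misses some color. -/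
def Removed [Fintype χ] (v : V) : Prop := slotSize σ l v ≠ Fintype.card χ

instance [Fintype χ] : DecidablePred (Removed σ l) :=
  fun v => inferInstanceAs (Decidable (slotSize σ l v ≠ Fintype.card χ))

/-- The number of earlier removed vertices of the same color. -/
def removedRank [Fintype χ] (v : V) : ℕ := #{u | u < v ∧ Removed σ l u ∧ σ u = σ v}

/-- Vertices in slots with all colors keep their cluster; the removed ones form clusters
with one vertex of each color. -/
def fairLabel [Fintype χ] (v : V) : Λ ⊕ ℕ :=
  if Removed σ l v then .inr (removedRank σ l v) else .inl (l v)

theorem level_eq (v : V) {x : Λ} {c : χ} (hx : l v = x) (hc : σ v = c) :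
    level σ l v = #{u ∈ ({u | l u = x ∧ σ u = c} : Finset V) | u < v} := by
  subst hx hc
  rw [level, filter_filter]
  congr 1; ext u; simp; tauto

theorem removedRank_eq [Fintype χ] (v : V) {c : χ} (hc : σ v = c) :
    removedRank σ l v = #{u ∈ ({u | Removed σ l u ∧ σ u = c} : Finset V) | u < v} := by
  subst hc
  rw [removedRank, filter_filter]
  congr 1; ext u; simp; tauto

variable {σ l}

theorem eq_of_level_eq {u v : V} (hl : l u = l v) (hσ : σ u = σ v)
    (h : level σ l u = level σ l v) : u = v := by
  rw [level_eq σ l u hl hσ, level_eq σ l v rfl rfl] at h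
  exact card_filter_lt_injOn _ (by simp [hl, hσ]) (by simp) h

variable [Fintype χ]

/-- Colors are distinct within a slot, so its size is $|\chi|$ exactly when no color is missing. The
program tests the size. -/
theorem not_removed_iff {v : V} :
    ¬ Removed σ l v ↔ ∀ c, ∃ u, l u = l v ∧ level σ l u = level σ l v ∧ σ u = c := by
  have hinj : Set.InjOn σ
      (({u | l u = l v ∧ level σ l u = level σ l v} : Finset V) : Set V) := by
    intro u hu w hw h
    simp only [coe_filter, mem_univ, true_and, Set.mem_ofPred_eq] at hu hw
    exact eq_of_level_eq (hu.1.trans hw.1.symm) h (hu.2.trans hw.2.symm)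
  rw [Removed, not_not, slotSize, ← card_image_of_injOn hinj, card_eq_iff_eq_univ,
    eq_univ_iff_forall]
  simp [and_assoc]

theorem removed_congr {u v : V} (hl : l u = l v) (h : level σ l u = level σ l v) :
    Removed σ l u ↔ Removed σ l v := by
  rw [← not_iff_not, not_removed_iff, not_removed_iff, hl, h]

theorem eq_of_removedRank_eq {u v : V} (hu : Removed σ l u) (hv : Removed σ l v)
    (hσ : σ u = σ v) (h : removedRank σ l u = removedRank σ l v) : u = v := by
  rw [removedRank_eq σ l u hσ, removedRank_eq σ l v rfl] at h
  exact card_filter_lt_injOn _ (by simp [hu, hσ]) (by simp [hv]) h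

variable (σ l)

/-- Sending a kept vertex to the vertex of color `c'` in its slot is injective on one color. -/
theorem card_kept_le (x : Λ) (c c' : χ) :
    #{v | l v = x ∧ ¬ Removed σ l v ∧ σ v = c} ≤ #{v | l v = x ∧ ¬ Removed σ l v ∧ σ v = c'} := by
  have : ∀ v, ∃ u, ¬ Removed σ l v →
      l u = l v ∧ level σ l u = level σ l v ∧ σ u = c' := by
    intro v
    by_cases h : Removed σ l v
    · exact ⟨v, fun h' => absurd h h'⟩
    · obtain ⟨u, hu⟩ := not_removed_iff.1 h c'
      exact ⟨u, fun _ => hu⟩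
  choose f hf using this
  refine card_le_card_of_injOn f (fun v hv => ?_) (fun v hv w hw h => ?_)
  · simp only [coe_filter, mem_univ, true_and, Set.mem_ofPred_eq] at hv ⊢
    obtain ⟨h1, h2, h3⟩ := hf v hv.2.1
    exact ⟨h1.trans hv.1, fun h => hv.2.1 ((removed_congr h1 h2).1 h), h3⟩
  · simp only [coe_filter, mem_univ, true_and, Set.mem_ofPred_eq] at hv hw
    obtain ⟨h1, h2, h3⟩ := hf v hv.2.1
    obtain ⟨h1', h2', h3'⟩ := hf w hw.2.1
    rw [h] at h2
    exact eq_of_level_eq (hv.1.trans hw.1.symm) (hv.2.2.trans hw.2.2.symm) (h2.symm.trans h2')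

theorem card_kept_eq (x : Λ) (c c' : χ) :
    #{v | l v = x ∧ ¬ Removed σ l v ∧ σ v = c} = #{v | l v = x ∧ ¬ Removed σ l v ∧ σ v = c'} :=
  (card_kept_le σ l x c c').antisymm (card_kept_le σ l x c' c)

/-- The color classes are equally large and the kept vertices are balanced in every cluster;
subtract. -/
theorem card_removed_eq (hσ : EqualColorClasses σ) (c c' : χ) :
    #{v | Removed σ l v ∧ σ v = c} = #{v | Removed σ l v ∧ σ v = c'} := by
  have split : ∀ c, #{v | σ v = c} =
      #{v | Removed σ l v ∧ σ v = c} + #{v | ¬ Removed σ l v ∧ σ v = c} := by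
    intro c
    rw [← card_filter_add_card_filter_not (s := {v | σ v = c}) (Removed σ l),
      filter_filter, filter_filter]
    simp only [and_comm]
  have kept : ∀ c, #{v | ¬ Removed σ l v ∧ σ v = c} =
      ∑ x ∈ univ.image l, #{v | l v = x ∧ ¬ Removed σ l v ∧ σ v = c} := by
    intro c
    rw [card_eq_sum_card_fiberwise (f := l) (t := univ.image l) (fun v _ => by simp)]
    refine sum_congr rfl fun x _ => ?_
    rw [filter_filter]
    congr 1; ext v; simp; tauto
  have h := hσ c c'
  classical
  rw [colorCount_eq_card, colorCount_eq_card] at h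
  simp only [Set.mem_univ, true_and] at h
  rw [split c, split c', kept c, kept c',
    sum_congr rfl fun x _ => card_kept_eq σ l x c c'] at h
  exact Nat.add_right_cancel h

theorem isFair_fairLabel (hσ : EqualColorClasses σ) : IsFair σ (Setoid.ker (fairLabel σ l)) := by
  rintro F ⟨w, rfl⟩ c c'
  rw [hσ c' c]
  congr 1
  have : ∀ c, colorCount σ c {x | Setoid.ker (fairLabel σ l) x w} =
      #{v | fairLabel σ l v = fairLabel σ l w ∧ σ v = c} := by
    intro c
    classical
    rw [colorCount_eq_card]
    congr 1
    ext v
    simp [Setoid.ker_def]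
  rw [this, this]
  -- A new cluster has one vertex of each color whose removed vertices outnumber the rank; an old
  -- one consists of its full slots.
  by_cases hw : Removed σ l w
  · have : ∀ c, #{v | fairLabel σ l v = fairLabel σ l w ∧ σ v = c} =
        if removedRank σ l w < #{v | Removed σ l v ∧ σ v = c} then 1 else 0 := by
      intro c
      rw [← card_filter_card_filter_lt_eq, filter_filter]
      congr 1
      ext v
      by_cases hv : Removed σ l v
      · simp only [fairLabel, hv, hw, mem_filter, mem_univ, if_true, Sum.inr.injEq, true_and]
        constructor
        · rintro ⟨h, hc⟩
          exact ⟨hc, by rw [← removedRank_eq σ l v hc, h]⟩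
        · rintro ⟨hc, h⟩
          exact ⟨by rw [removedRank_eq σ l v hc, h], hc⟩
      · simp [fairLabel, hv, hw]
    rw [this, this, card_removed_eq σ l hσ c c']
  · have : ∀ c, #{v | fairLabel σ l v = fairLabel σ l w ∧ σ v = c} =
        #{v | l v = l w ∧ ¬ Removed σ l v ∧ σ v = c} := by
      intro c
      congr 1
      ext v
      by_cases hv : Removed σ l v <;> simp [fairLabel, hv, hw]
    rw [this, this, card_kept_eq σ l (l w) c c']

/-- Turning a cluster into its full slots removes at most `|χ| - 1` times as many vertices as
any change of the cluster into a color-balanced set. -/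
theorem card_removed_le (x : Λ) (F : Finset V) (b : ℕ) (hF : ∀ c, #{v ∈ F | σ v = c} = b) :
    #{v | l v = x ∧ Removed σ l v} ≤
      (Fintype.card χ - 1) * #{v | ¬ (l v = x ↔ v ∈ F)} := by
  rcases isEmpty_or_nonempty χ with hχ | hχ
  · have : IsEmpty V := ⟨fun v => hχ.elim (σ v)⟩
    simp
  let a : χ → ℕ := fun c => #{v | l v = x ∧ σ v = c}
  obtain ⟨c₀, hc₀⟩ := Finite.exists_min a
  -- Every vertex of the rarest color `c₀` is kept: its level is below `a c₀`, hence below `a c` for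
  -- each `c`, so its slot is full.
  have kept : ∀ c, #{v | l v = x ∧ ¬ Removed σ l v ∧ σ v = c} = a c₀ := by
    intro c
    rw [card_kept_eq σ l x c c₀]
    congr 1
    ext v
    simp only [mem_filter, mem_univ, true_and, and_congr_right_iff, and_iff_right_iff_imp]
    intro hx hv
    rw [not_removed_iff]
    intro c
    have h1 : level σ l v < a c := by
      rw [level_eq σ l v hx hv]
      exact (card_filter_lt_lt_card (by simp [hx, hv])).trans_le (hc₀ c)
    obtain ⟨u, hu, h⟩ := exists_card_filter_lt_eq h1
    simp only [mem_filter, mem_univ, true_and] at hu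
    exact ⟨u, hu.1.trans hx.symm, by rw [level_eq σ l u hu.1 hu.2, h], hu.2⟩
  have split : ∀ c, #{v | (l v = x ∧ Removed σ l v) ∧ σ v = c} + a c₀ = a c := by
    intro c
    rw [← kept c]
    show _ = #{v | l v = x ∧ σ v = c}
    rw [← card_filter_add_card_filter_not (s := {v | l v = x ∧ σ v = c}) (Removed σ l),
      filter_filter, filter_filter]
    congr 2 <;> (ext v; simp; try tauto)
  let δ : χ → Finset V := fun c => {v | (¬ (l v = x ↔ v ∈ F)) ∧ σ v = c}
  have up : ∀ c, a c ≤ b + #(δ c) := by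
    intro c
    rw [← hF c]
    refine (card_le_card fun v hv => ?_).trans (card_union_le _ _)
    simp only [δ, mem_union, mem_filter, mem_univ, true_and] at hv ⊢
    tauto
  have down : ∀ c, b ≤ a c + #(δ c) := by
    intro c
    rw [← hF c]
    refine (card_le_card fun v hv => ?_).trans (card_union_le _ _)
    simp only [δ, mem_union, mem_filter, mem_univ, true_and] at hv ⊢
    tauto
  rw [card_eq_sum_card_fiberwise (f := σ) (t := univ) (fun v _ => by simp),
    ← add_sum_erase univ _ (mem_univ c₀)]
  have h0 : #{v ∈ ({v | l v = x ∧ Removed σ l v} : Finset V) | σ v = c₀} = 0 := by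
    rw [filter_filter]
    have := split c₀
    omega
  rw [h0, zero_add, ← card_univ, ← card_erase_of_mem (mem_univ c₀), ← smul_eq_mul]
  refine sum_le_card_nsmul _ _ _ fun c hc => ?_
  rw [filter_filter]
  -- Disjointness lets both deviations be charged to the symmetric difference once, avoiding a
  -- factor 2.
  have hd : Disjoint (δ c) (δ c₀) := by
    rw [disjoint_left]
    intro v hv hv'
    simp only [δ, mem_filter, mem_univ, true_and] at hv hv'
    exact ne_of_mem_erase hc (hv.2.symm.trans hv'.2)
  have hsub : #(δ c) + #(δ c₀) ≤ #{v | ¬ (l v = x ↔ v ∈ F)} := by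
    rw [← card_union_of_disjoint hd]
    refine card_le_card fun v hv => ?_
    simp only [δ, mem_union, mem_filter, mem_univ, true_and] at hv ⊢
    tauto
  have := split c
  have := up c
  have := down c₀
  omega

/-- The factor 3 comes from three contributions, each at most `m * ∑ v, μ v`: vertices losing
removed companions, removed vertices losing their old cluster, and removed vertices gaining at most
`m` new companions. -/
theorem dist_fairLabel_le (hσ : EqualColorClasses σ) {𝓕 : Setoid V} (h𝓕 : IsFair σ 𝓕) :
    dist (Setoid.ker l) (Setoid.ker (fairLabel σ l)) ≤
      3 * (Fintype.card χ - 1) * dist (Setoid.ker l) 𝓕 := by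
  classical
  set m := Fintype.card χ - 1
  let e : V → ℕ := fun v => #{u | l u = l v ∧ Removed σ l u}
  let μ : V → ℕ := fun v => #{u | ¬ (Setoid.ker l v u ↔ 𝓕 v u)}
  have he : ∀ v, e v ≤ m * μ v := by
    intro v
    obtain ⟨b, hb⟩ := exists_balanced hσ h𝓕 v
    refine (card_removed_le σ l (l v) {u | 𝓕 v u} b hb).trans (le_of_eq ?_)
    congr 2
    ext u
    simp [Setoid.ker_def, eq_comm]
  let R : Finset V := {v | Removed σ l v}
  have hpt : ∀ v, #{u | ¬ (Setoid.ker l v u ↔ Setoid.ker (fairLabel σ l) v u)} ≤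
      e v + (if Removed σ l v then #{u | l u = l v} + m else 0) := by
    intro v
    split_ifs with hv
    -- The new cluster of `v` is rainbow, so its other vertices have distinct colors different from
    -- `σ v`.
    · have h1 : #{u | l u ≠ l v ∧ fairLabel σ l u = fairLabel σ l v} ≤ m := by
        have : m = #(univ.erase (σ v)) := by rw [card_erase_of_mem (mem_univ _), card_univ]
        rw [this]
        have hrem : ∀ u, fairLabel σ l u = fairLabel σ l v →
            Removed σ l u ∧ removedRank σ l u = removedRank σ l v := by
          intro u hu
          by_cases h : Removed σ l u
          · simpa [fairLabel, h, hv] using hu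
          · simp [fairLabel, h, hv] at hu
        refine card_le_card_of_injOn σ (fun u hu => ?_) (fun u hu w hw h => ?_)
        · simp only [coe_filter, mem_univ, true_and, Set.mem_ofPred_eq] at hu
          obtain ⟨h1, h2⟩ := hrem u hu.2
          simp only [coe_erase, coe_univ, Set.mem_sdiff, Set.mem_univ, true_and,
            Set.mem_singleton_iff]
          exact fun h => hu.1 (congrArg l (eq_of_removedRank_eq h1 hv h h2))
        · simp only [coe_filter, mem_univ, true_and, Set.mem_ofPred_eq] at hu hw
          obtain ⟨h1, h2⟩ := hrem u hu.2
          obtain ⟨h3, h4⟩ := hrem w hw.2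
          exact eq_of_removedRank_eq h1 h3 h (h2.trans h4.symm)
      have h2 : #{u | ¬ (Setoid.ker l v u ↔ Setoid.ker (fairLabel σ l) v u)} ≤
          #{u | l u = l v} + #{u | l u ≠ l v ∧ fairLabel σ l u = fairLabel σ l v} := by
        refine (card_le_card fun u hu => ?_).trans (card_union_le _ _)
        simp only [mem_filter, mem_univ, true_and, mem_union, Setoid.ker_def,
          eq_comm (a := l v), eq_comm (a := fairLabel σ l v)] at hu ⊢
        tauto
      omega
    · refine card_le_card fun u hu => ?_
      simp only [mem_filter, mem_univ, true_and, Setoid.ker_def] at hu ⊢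
      by_cases h : Removed σ l u
      · refine ⟨?_, h⟩
        by_contra h'
        exact hu (by simp [fairLabel, h, hv, eq_comm (a := l v), h'])
      · exact absurd (by simp [fairLabel, h, hv]) hu
  -- Both sides count pairs of a removed vertex and a vertex of its cluster.
  have hR : ∑ v ∈ R, #{u | l u = l v} = ∑ v, e v := by
    simp only [e, card_filter, R, sum_filter]
    rw [sum_comm]
    refine sum_congr rfl fun v _ => ?_
    by_cases h : Removed σ l v <;> simp [h, eq_comm]
  -- A removed `v` counts itself in `e v`, so `he` forces `μ v ≥ 1`.
  have hRm : #R ≤ ∑ v, μ v := by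
    rw [card_eq_sum_ones]
    refine (sum_le_sum fun v hv => ?_).trans (sum_le_sum_of_subset (subset_univ R))
    have h1 : 0 < e v := card_pos.2 ⟨v, by simpa [R] using hv⟩
    exact Nat.pos_of_mul_pos_left (h1.trans_le (he v))
  have hfin : 2 * dist (Setoid.ker l) (Setoid.ker (fairLabel σ l)) ≤
      3 * m * (2 * dist (Setoid.ker l) 𝓕) := by
    rw [two_mul_dist, two_mul_dist (Setoid.ker l) 𝓕]
    calc _ ≤ ∑ v, (e v + (if Removed σ l v then #{u | l u = l v} + m else 0)) :=
          sum_le_sum fun v _ => hpt v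
      _ = ∑ v, e v + (∑ v, e v + #R * m) := by
          rw [sum_add_distrib, ← sum_filter, sum_add_distrib, hR, sum_const, smul_eq_mul]
      _ ≤ m * ∑ v, μ v + (m * ∑ v, μ v + (∑ v, μ v) * m) := by
          have : ∑ v, e v ≤ m * ∑ v, μ v := by
            rw [mul_sum]; exact sum_le_sum fun v _ => he v
          gcongr
      _ = 3 * m * ∑ v, μ v := by ring
  nlinarith [hfin]

end Combinatorics

end FairClustering

namespace FairClustering

/-! ### Correctness and running time of the counting loops -/

section Program

open Finset

/-- Absolute difference. -/
def Expr.absDiff (e₁ e₂ : Expr) : Expr := .add (.sub e₁ e₂) (.sub e₂ e₁)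

theorem Expr.eval_absDiff_eq_zero {e₁ e₂ : Expr} {s : Store} :
    (Expr.absDiff e₁ e₂).eval s = 0 ↔ e₁.eval s = e₂.eval s := by
  simp only [Expr.absDiff, Expr.eval]
  omega

/-- Increments register 4 by the number of `u` with `reg 3 ≤ u < reg 0` such that `e` vanishes
when register 3 contains `u`. -/
def countProg (e : Expr) : Prog :=
  .loop (.sub (.reg 0) (.reg 3))
    (.seq (.ite e .skip (.assign 4 (.add (.reg 4) (.const 1))))
      (.assign 3 (.add (.reg 3) (.const 1))))

/-- For each `v < reg 0`, writes to array `a` at place `v` the value of `r` when register 2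
contains `v` and register 4 the number of `u < reg 0` for which `e` vanishes. -/
def tableProg (a : ℕ) (e r : Expr) : Prog :=
  .seq (.assign 2 (.const 0))
    (.loop (.sub (.reg 0) (.reg 2))
      (.seq (.assign 4 (.const 0)) (.seq (.assign 3 (.const 0)) (.seq (countProg e)
        (.seq (.write a (.reg 2) r) (.assign 2 (.add (.reg 2) (.const 1))))))))

/-- The stores agree in registers 0 and 1 and in all arrays but `a`. -/
def SameInput (a : ℕ) (s s' : Store) : Prop :=
  s'.reg 0 = s.reg 0 ∧ s'.reg 1 = s.reg 1 ∧ ∀ b, b ≠ a → s'.arr b = s.arr b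

theorem SameInput.trans {a : ℕ} {s s' s'' : Store} (h : SameInput a s s')
    (h' : SameInput a s' s'') : SameInput a s s'' :=
  ⟨h'.1.trans h.1, h'.2.1.trans h.2.1, fun b hb => (h'.2.2 b hb).trans (h.2.2 b hb)⟩

theorem SameInput.setReg {a : ℕ} (s : Store) {x : ℕ} (hx : 1 < x) (k : ℕ) :
    SameInput a s (s.setReg x k) :=
  ⟨Function.update_of_ne (by omega) _ _, Function.update_of_ne (by omega) _ _, fun _ _ => rfl⟩

theorem SameInput.setArr {a : ℕ} (s : Store) (i k : ℕ) : SameInput a s (s.setArr a i k) :=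
  ⟨rfl, rfl, fun _ hb => Function.update_of_ne hb _ _⟩

/-- Induction on the number `k` of passes left. A pass costs at most 4 for the test, `e.cost + 5`
for the branch and 4 for the increment; the last failing test costs 4. -/
theorem exec_countProg {a : ℕ} {e : Expr} {s₀ : Store} {p : ℕ → ℕ → Prop}
    [∀ v, DecidablePred (p v)]
    (he : ∀ s, SameInput a s₀ s → (e.eval s = 0 ↔ p (s.reg 2) (s.reg 3))) (k : ℕ) :
    ∀ s : Store, SameInput a s₀ s → s.reg 3 + k = s.reg 0 →
      s.reg 4 = #{u ∈ range (s.reg 3) | p (s.reg 2) u} →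
      ∃ t s', Exec (countProg e) s t s' ∧ t ≤ k * (e.cost + 13) + 4 ∧ SameInput a s₀ s' ∧
        s'.reg 2 = s.reg 2 ∧ s'.arr = s.arr ∧
        s'.reg 4 = #{u ∈ range (s.reg 0) | p (s.reg 2) u} := by
  induction k with
  | zero =>
    intro s hs h3 h4
    refine ⟨_, s, Exec.loopDone ?_, ?_, hs, rfl, rfl, ?_⟩
    · simp only [Expr.eval]; omega
    · simp [Expr.cost]
    · rw [h4, ← h3, add_zero]
  | succ k ih =>
    intro s hs h3 h4
    have hcond : (Expr.sub (.reg 0) (.reg 3)).eval s ≠ 0 := by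
      simp only [Expr.eval]; omega
    obtain ⟨t₁, s₁, hex, ht₁, hs₁, h2', h3', harr, h4'⟩ : ∃ t₁ s₁,
        Exec (.ite e .skip (.assign 4 (.add (.reg 4) (.const 1)))) s t₁ s₁ ∧
        t₁ ≤ e.cost + 5 ∧ SameInput a s s₁ ∧ s₁.reg 2 = s.reg 2 ∧ s₁.reg 3 = s.reg 3 ∧
        s₁.arr = s.arr ∧ s₁.reg 4 = #{u ∈ range (s.reg 3 + 1) | p (s.reg 2) u} := by
      by_cases h : e.eval s = 0
      · refine ⟨_, _, Exec.iteFalse h (Exec.assign _ _ _), ?_,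
          SameInput.setReg s (by omega) _, ?_, ?_, rfl, ?_⟩
        · simp [Expr.cost]
        · simp [Store.setReg]
        · simp [Store.setReg]
        · rw [he s hs] at h
          simp [Store.setReg, Expr.eval, h4, range_add_one, filter_insert, h]
      · refine ⟨_, _, Exec.iteTrue h (Exec.skip _), by omega, ⟨rfl, rfl, fun _ _ => rfl⟩,
          rfl, rfl, rfl, ?_⟩
        rw [he s hs] at h
        simp [h4, range_add_one, filter_insert, h]
    have hs₂ := SameInput.setReg (a := a) s₁ (x := 3) (by omega)
      ((Expr.add (.reg 3) (.const 1)).eval s₁)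
    have hstep := Exec.seq hex (Exec.assign 3 (.add (.reg 3) (.const 1)) s₁)
    set s₂ := s₁.setReg 3 ((Expr.add (.reg 3) (.const 1)).eval s₁) with hs₂def
    have e3 : s₂.reg 3 = s.reg 3 + 1 := by
      simp [hs₂def, Store.setReg, Expr.eval, h3']
    have e2 : s₂.reg 2 = s.reg 2 := by simp [hs₂def, Store.setReg, h2']
    have e4 : s₂.reg 4 = s₁.reg 4 := by simp [hs₂def, Store.setReg]
    have e0 : s₂.reg 0 = s.reg 0 := hs₂.1.trans hs₁.1
    obtain ⟨t₃, s₃, hex₃, ht₃, hs₃, h2₃, harr₃, h4₃⟩ :=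
      ih s₂ (hs.trans (hs₁.trans hs₂)) (by omega) (by rw [e4, h4', e3, e2])
    refine ⟨_, s₃, Exec.loopStep hcond hstep hex₃, ?_, hs₃, h2₃.trans e2,
      harr₃.trans harr, by rw [h4₃, e0, e2]⟩
    simp only [Expr.cost]
    rw [add_mul]
    omega

theorem exec_tableLoop {a : ℕ} {e r : Expr} {s₀ : Store} {p : ℕ → ℕ → Prop}
    {g : ℕ → ℕ → ℕ} [∀ v, DecidablePred (p v)]
    (he : ∀ s, SameInput a s₀ s → (e.eval s = 0 ↔ p (s.reg 2) (s.reg 3)))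
    (hr : ∀ s, SameInput a s₀ s → r.eval s = g (s.reg 2) (s.reg 4)) (k : ℕ) :
    ∀ s : Store, SameInput a s₀ s → s.reg 2 + k = s.reg 0 →
      (∀ v < s.reg 2, s.arr a v = g v #{u ∈ range (s.reg 0) | p v u}) →
      ∃ t s', Exec (.loop (.sub (.reg 0) (.reg 2))
        (.seq (.assign 4 (.const 0)) (.seq (.assign 3 (.const 0)) (.seq (countProg e)
          (.seq (.write a (.reg 2) r) (.assign 2 (.add (.reg 2) (.const 1)))))))) s t s' ∧
        t ≤ k * (s.reg 0 * (e.cost + 13) + r.cost + 20) + 4 ∧ SameInput a s₀ s' ∧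
        ∀ v < s.reg 0, s'.arr a v = g v #{u ∈ range (s.reg 0) | p v u} := by
  induction k with
  | zero =>
    intro s hs h2 hv
    refine ⟨_, s, Exec.loopDone ?_, ?_, hs, ?_⟩
    · simp only [Expr.eval]; omega
    · simp [Expr.cost]
    · rw [add_zero] at h2
      exact fun v hvl => hv v (h2 ▸ hvl)
  | succ k ih =>
    intro s hs h2 hv
    have hcond : (Expr.sub (.reg 0) (.reg 2)).eval s ≠ 0 := by
      simp only [Expr.eval]; omega
    have x₁ := Exec.assign 4 (.const 0) s
    have i₁ := SameInput.setReg (a := a) s (x := 4) (by omega) ((Expr.const 0).eval s)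
    set s₁ := s.setReg 4 ((Expr.const 0).eval s) with hs₁
    have x₂ := Exec.assign 3 (.const 0) s₁
    have i₂ := SameInput.setReg (a := a) s₁ (x := 3) (by omega) ((Expr.const 0).eval s₁)
    set s₂ := s₁.setReg 3 ((Expr.const 0).eval s₁) with hs₂
    have e2 : s₂.reg 2 = s.reg 2 := by simp [hs₂, hs₁, Store.setReg]
    have e3 : s₂.reg 3 = 0 := by simp [hs₂, hs₁, Store.setReg, Expr.eval]
    have e4 : s₂.reg 4 = 0 := by simp [hs₂, hs₁, Store.setReg, Expr.eval]
    have e0 : s₂.reg 0 = s.reg 0 := i₂.1.trans i₁.1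
    obtain ⟨t₃, s₃, x₃, ht₃, i₃, h2₃, harr₃, h4₃⟩ :=
      exec_countProg he (s.reg 0) s₂ (hs.trans (i₁.trans i₂)) (by omega)
        (by rw [e4, e3]; simp)
    have x₄ := Exec.write a (.reg 2) r s₃
    have i₄ := SameInput.setArr (a := a) s₃ ((Expr.reg 2).eval s₃) (r.eval s₃)
    have harr₄ : ∀ v < s.reg 2 + 1, (s₃.setArr a ((Expr.reg 2).eval s₃) (r.eval s₃)).arr a v =
        g v #{u ∈ range (s.reg 0) | p v u} := by
      intro v hvl
      have hi : (Expr.reg 2).eval s₃ = s.reg 2 := h2₃.trans e2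
      rw [hi, hr s₃ i₃, h2₃, e2, h4₃, e0, e2]
      by_cases hve : v = s.reg 2
      · subst hve
        simp [Store.setArr]
      · simp only [Store.setArr, Function.update_self, Function.update_of_ne hve]
        rw [harr₃]
        exact hv v (by omega)
    have e2₄ : (s₃.setArr a ((Expr.reg 2).eval s₃) (r.eval s₃)).reg 2 = s.reg 2 := h2₃.trans e2
    set s₄ := s₃.setArr a ((Expr.reg 2).eval s₃) (r.eval s₃)
    have x₅ := Exec.assign 2 (.add (.reg 2) (.const 1)) s₄
    have i₅ := SameInput.setReg (a := a) s₄ (x := 2) (by omega)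
      ((Expr.add (.reg 2) (.const 1)).eval s₄)
    have e2₅ : (s₄.setReg 2 ((Expr.add (.reg 2) (.const 1)).eval s₄)).reg 2 = s.reg 2 + 1 := by
      simp [Store.setReg, Expr.eval, e2₄]
    have harr₅ : (s₄.setReg 2 ((Expr.add (.reg 2) (.const 1)).eval s₄)).arr = s₄.arr := rfl
    set s₅ := s₄.setReg 2 ((Expr.add (.reg 2) (.const 1)).eval s₄)
    have i := i₃.trans (i₄.trans i₅)
    have e0₅ : s₅.reg 0 = s.reg 0 := i.1.trans hs.1.symm
    obtain ⟨t₆, s₆, x₆, ht₆, i₆, hv₆⟩ := ih s₅ i (by omega)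
      (by rw [e2₅, e0₅, harr₅]; exact harr₄)
    rw [e0₅] at hv₆ ht₆
    refine ⟨_, s₆, Exec.loopStep hcond (x₁.seq (x₂.seq (x₃.seq (x₄.seq x₅)))) x₆, ?_, i₆, hv₆⟩
    simp only [Expr.cost]
    rw [add_mul]
    omega

theorem exec_tableProg {a : ℕ} {e r : Expr} {s : Store} {p : ℕ → ℕ → Prop}
    {g : ℕ → ℕ → ℕ} [∀ v, DecidablePred (p v)]
    (he : ∀ s', SameInput a s s' → (e.eval s' = 0 ↔ p (s'.reg 2) (s'.reg 3)))
    (hr : ∀ s', SameInput a s s' → r.eval s' = g (s'.reg 2) (s'.reg 4)) :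
    ∃ t s', Exec (tableProg a e r) s t s' ∧
      t ≤ s.reg 0 * (s.reg 0 * (e.cost + 13) + r.cost + 20) + 6 ∧ SameInput a s s' ∧
      ∀ v < s.reg 0, s'.arr a v = g v #{u ∈ range (s.reg 0) | p v u} := by
  have i₁ := SameInput.setReg (a := a) s (x := 2) (by omega) ((Expr.const 0).eval s)
  have e2 : (s.setReg 2 ((Expr.const 0).eval s)).reg 2 = 0 := by simp [Store.setReg, Expr.eval]
  obtain ⟨t, s', hx, ht, hs', hv⟩ := exec_tableLoop he hr (s.reg 0) _ i₁
    (by rw [e2, i₁.1, zero_add]) (by rw [e2]; simp)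
  rw [i₁.1] at hv ht
  refine ⟨_, s', (Exec.assign 2 (.const 0) s).seq hx, ?_, hs', hv⟩
  simp only [Expr.cost]
  omega

end Program

end FairClustering

namespace FairClustering

/-! ### The algorithm and its output -/

section Algorithm

open Finset

theorem card_filter_range_eq {n : ℕ} {p : ℕ → Prop} {_ : DecidablePred p} {q : Fin n → Prop}
    {_ : DecidablePred q} (h : ∀ u : Fin n, p u ↔ q u) : #{u ∈ range n | p u} = #{u | q u} := by
  rw [card_filter, card_filter, ← Fin.sum_univ_eq_sum_range (fun u => if p u then 1 else 0)]
  simp [h]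

theorem table_time_le {n c r : ℕ} (hc : c ≤ 87) (hr : r ≤ 80) :
    n * (n * (c + 13) + r + 20) + 6 ≤ n * (n * 100 + 100) + 100 := by
  have h : n * (c + 13) ≤ n * 100 := Nat.mul_le_mul_left n (by omega)
  have := Nat.mul_le_mul_left n (show n * (c + 13) + r + 20 ≤ n * 100 + 100 by omega)
  omega

/-- Vanishes iff register 3 is less than `e`. -/
def ltExpr (e : Expr) : Expr := .sub (.add (.reg 3) (.const 1)) e

/-- Vanishes iff array `a` has the same entry at the places in registers 2 and 3. -/
def sameExpr (a : ℕ) : Expr := .absDiff (.entry a (.reg 3)) (.entry a (.reg 2))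

/-- Vanishes iff both do. -/
def andExpr (e₁ e₂ : Expr) : Expr := .add e₁ e₂

/-- Vanishes iff one of the two does. -/
def orExpr (e₁ e₂ : Expr) : Expr := .sub e₁ (.sub e₁ e₂)

/-- Is `0` if `e` is positive and `1` otherwise. -/
def notExpr (e : Expr) : Expr := .sub (.const 1) e

/-- Vanishes iff the entry of array 4 at the place in register `x` equals register 1. -/
def fullExpr (x : ℕ) : Expr := .absDiff (.entry 4 (.reg x)) (.reg 1)

theorem eval_ltExpr {e : Expr} {s : Store} : (ltExpr e).eval s = 0 ↔ s.reg 3 < e.eval s := by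
  simp only [ltExpr, Expr.eval]
  omega

theorem eval_sameExpr {a : ℕ} {s : Store} :
    (sameExpr a).eval s = 0 ↔ s.arr a (s.reg 3) = s.arr a (s.reg 2) :=
  Expr.eval_absDiff_eq_zero

theorem eval_andExpr {e₁ e₂ : Expr} {s : Store} :
    (andExpr e₁ e₂).eval s = 0 ↔ e₁.eval s = 0 ∧ e₂.eval s = 0 := by
  simp only [andExpr, Expr.eval]
  omega

/-- With truncated subtraction, $x-(x-y)=\min(x,y)$. -/
theorem eval_orExpr {e₁ e₂ : Expr} {s : Store} :
    (orExpr e₁ e₂).eval s = 0 ↔ e₁.eval s = 0 ∨ e₂.eval s = 0 := by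
  simp only [orExpr, Expr.eval]
  omega

theorem eval_notExpr {e : Expr} {s : Store} : (notExpr e).eval s = 0 ↔ e.eval s ≠ 0 := by
  simp only [notExpr, Expr.eval]
  omega

theorem eval_notExpr_eq {e : Expr} {s : Store} :
    (notExpr e).eval s = if e.eval s = 0 then 1 else 0 := by
  simp only [notExpr, Expr.eval]
  split_ifs <;> omega

theorem eval_fullExpr {x : ℕ} {s : Store} :
    (fullExpr x).eval s = 0 ↔ s.arr 4 (s.reg x) = s.reg 1 :=
  Expr.eval_absDiff_eq_zero

/-- Array 3 receives the levels. -/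
def levelProg : Prog :=
  tableProg 3 (andExpr (ltExpr (.reg 2)) (andExpr (sameExpr 1) (sameExpr 0))) (.reg 4)

/-- Array 4 receives the slot sizes. -/
def slotProg : Prog :=
  tableProg 4 (andExpr (sameExpr 1) (sameExpr 3)) (.reg 4)

/-- Array 2 receives `2 * label v` for the kept vertices `v`, and `2 * rank v + 1` for the
removed ones. -/
def outputProg : Prog :=
  tableProg 2
    (orExpr (andExpr (fullExpr 2) (ltExpr (.entry 1 (.reg 2))))
      (andExpr (notExpr (fullExpr 2))
        (andExpr (ltExpr (.reg 2)) (andExpr (notExpr (fullExpr 3)) (sameExpr 0)))))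
    (.add (.add (.reg 4) (.reg 4)) (notExpr (notExpr (fullExpr 2))))

/-- The clustering algorithm. -/
def fairProg : Prog := .seq levelProg (.seq slotProg outputProg)

/-- The code of a label as a natural number. -/
def encodeLabel {n : ℕ} : Fin n ⊕ ℕ → ℕ
  | .inl x => 2 * x
  | .inr k => 2 * k + 1

theorem encodeLabel_injective {n : ℕ} : Function.Injective (encodeLabel (n := n)) := by
  rintro (x | k) (y | j) h <;> simp only [encodeLabel] at h
  · exact congrArg _ (Fin.ext (by omega))
  · omega
  · omega
  · exact congrArg _ (by omega)

variable {n d : ℕ} (σ : Fin n → Fin d) (label : Fin n → Fin n)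

theorem exec_levelProg : ∃ t s, Exec levelProg (inputStore σ label) t s ∧
    t ≤ n * (n * 100 + 100) + 100 ∧ SameInput 3 (inputStore σ label) s ∧
    ∀ v : Fin n, s.arr 3 v = level σ label v := by
  obtain ⟨t, s, hx, ht, hs, hv⟩ := exec_tableProg (a := 3) (s := inputStore σ label)
    (e := andExpr (ltExpr (.reg 2)) (andExpr (sameExpr 1) (sameExpr 0))) (r := .reg 4)
    (p := fun v u => u < v ∧ (inputStore σ label).arr 1 u = (inputStore σ label).arr 1 v ∧
      (inputStore σ label).arr 0 u = (inputStore σ label).arr 0 v) (g := fun _ k => k)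
    (fun s' h => by
      rw [eval_andExpr, eval_andExpr, eval_ltExpr, eval_sameExpr, eval_sameExpr,
        h.2.2 1 (by decide), h.2.2 0 (by decide)]
      rfl)
    (fun _ _ => rfl)
  rw [show (inputStore σ label).reg 0 = n from rfl] at ht hv
  refine ⟨t, s, hx, ht.trans (table_time_le (by decide) (by decide)), hs, fun v => ?_⟩
  · rw [hv v v.2]
    refine card_filter_range_eq fun u => ?_
    simp [inputStore, Fin.ext_iff]

theorem exec_slotProg {s₀ : Store} (h0 : s₀.reg 0 = n) (h1 : ∀ v : Fin n, s₀.arr 1 v = label v)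
    (h3 : ∀ v : Fin n, s₀.arr 3 v = level σ label v) : ∃ t s, Exec slotProg s₀ t s ∧
    t ≤ n * (n * 100 + 100) + 100 ∧ SameInput 4 s₀ s ∧
    ∀ v : Fin n, s.arr 4 v = slotSize σ label v := by
  obtain ⟨t, s, hx, ht, hs, hv⟩ := exec_tableProg (a := 4) (s := s₀)
    (e := andExpr (sameExpr 1) (sameExpr 3)) (r := .reg 4)
    (p := fun v u => s₀.arr 1 u = s₀.arr 1 v ∧ s₀.arr 3 u = s₀.arr 3 v) (g := fun _ k => k)
    (fun s' h => by
      rw [eval_andExpr, eval_sameExpr, eval_sameExpr, h.2.2 1 (by decide), h.2.2 3 (by decide)])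
    (fun _ _ => rfl)
  rw [h0] at ht hv
  refine ⟨t, s, hx, ht.trans (table_time_le (by decide) (by decide)), hs, fun v => ?_⟩
  · rw [hv v v.2]
    refine card_filter_range_eq fun u => ?_
    rw [h1, h1, h3, h3, Fin.ext_iff]

theorem exec_outputProg {s₀ : Store} (h0 : s₀.reg 0 = n) (h1 : s₀.reg 1 = d)
    (hσ : ∀ v : Fin n, s₀.arr 0 v = σ v) (hl : ∀ v : Fin n, s₀.arr 1 v = label v)
    (h4 : ∀ v : Fin n, s₀.arr 4 v = slotSize σ label v) : ∃ t s, Exec outputProg s₀ t s ∧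
    t ≤ n * (n * 100 + 100) + 100 ∧
    ∀ v : Fin n, s.arr 2 v = encodeLabel (fairLabel σ label v) := by
  obtain ⟨t, s, hx, ht, hs, hv⟩ := exec_tableProg (a := 2) (s := s₀)
    (e := orExpr (andExpr (fullExpr 2) (ltExpr (.entry 1 (.reg 2))))
      (andExpr (notExpr (fullExpr 2))
        (andExpr (ltExpr (.reg 2)) (andExpr (notExpr (fullExpr 3)) (sameExpr 0)))))
    (r := .add (.add (.reg 4) (.reg 4)) (notExpr (notExpr (fullExpr 2))))
    (p := fun v u => (s₀.arr 4 v = d ∧ u < s₀.arr 1 v) ∨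
      (¬ s₀.arr 4 v = d ∧ u < v ∧ ¬ s₀.arr 4 u = d ∧ s₀.arr 0 u = s₀.arr 0 v))
    (g := fun v k => k + k + if s₀.arr 4 v = d then 0 else 1)
    (fun s' h => by
      simp only [eval_orExpr, eval_andExpr, eval_notExpr, eval_fullExpr, eval_ltExpr,
        eval_sameExpr, Expr.eval, h.2.1, h1, h.2.2 0 (by decide), h.2.2 1 (by decide),
        h.2.2 4 (by decide), ne_eq])
    (fun s' h => by
      simp only [Expr.eval, eval_notExpr_eq, eval_fullExpr, h.2.1, h1, h.2.2 4 (by decide)]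
      split_ifs <;> simp_all)
  rw [h0] at ht hv
  refine ⟨t, s, hx, ht.trans (table_time_le (by decide) (by decide)), fun v => ?_⟩
  · have hrem : ∀ u, Removed σ label u ↔ ¬ s₀.arr 4 u = d := by
      intro u
      rw [Removed, h4, Fintype.card_fin]
    rw [hv v v.2]
    by_cases h : s₀.arr 4 v = d
    · have hr : ¬ Removed σ label v := by rw [hrem]; exact not_not.2 h
      -- For a kept vertex the loop counts the numbers below its label; as labels are less than `n`,
      -- the count is the label itself.
      have : #{u ∈ range n | (s₀.arr 4 v = d ∧ u < s₀.arr 1 v) ∨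
          (¬ s₀.arr 4 v = d ∧ u < v ∧ ¬ s₀.arr 4 u = d ∧ s₀.arr 0 u = s₀.arr 0 v)} =
          #(range (label v : ℕ)) := by
        congr 1
        ext u
        have := (label v).2
        simp only [mem_filter, mem_range, h, hl, true_and, not_true, false_and, or_false]
        omega
      rw [this, card_range]
      simp only [fairLabel, hr, h, if_false, if_true, encodeLabel]
      omega
    · have hr : Removed σ label v := by rwa [hrem]
      have : #{u ∈ range n | (s₀.arr 4 v = d ∧ u < s₀.arr 1 v) ∨
          (¬ s₀.arr 4 v = d ∧ u < v ∧ ¬ s₀.arr 4 u = d ∧ s₀.arr 0 u = s₀.arr 0 v)} =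
          removedRank σ label v := by
        refine card_filter_range_eq fun u => ?_
        simp only [h, hrem, hσ, false_and, not_false_iff, true_and, false_or, Fin.ext_iff,
          Fin.lt_def]
      rw [this]
      simp only [fairLabel, hr, h, if_false, if_true, encodeLabel]
      omega

theorem exec_fairProg : ∃ t s, Exec fairProg (inputStore σ label) t s ∧
    t ≤ 3 * (n * (n * 100 + 100) + 100) ∧
    outputClustering n s = Setoid.ker (fairLabel σ label) := by
  have hσ : ∀ v : Fin n, (inputStore σ label).arr 0 v = σ v := fun v => by simp [inputStore]
  have hl : ∀ v : Fin n, (inputStore σ label).arr 1 v = label v := fun v => by simp [inputStore]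
  have h0 : (inputStore σ label).reg 0 = n := by simp [inputStore]
  have h1 : (inputStore σ label).reg 1 = d := by simp [inputStore]
  obtain ⟨t₁, s₁, x₁, ht₁, i₁, hv₁⟩ := exec_levelProg σ label
  obtain ⟨t₂, s₂, x₂, ht₂, i₂, hv₂⟩ := exec_slotProg σ label (i₁.1.trans h0)
    (fun v => by rw [i₁.2.2 1 (by decide), hl]) hv₁
  obtain ⟨t₃, s₃, x₃, ht₃, hv₃⟩ := exec_outputProg σ label (i₂.1.trans (i₁.1.trans h0))
    (i₂.2.1.trans (i₁.2.1.trans h1))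
    (fun v => by rw [i₂.2.2 0 (by decide), i₁.2.2 0 (by decide), hσ])
    (fun v => by rw [i₂.2.2 1 (by decide), i₁.2.2 1 (by decide), hl]) hv₂
  refine ⟨_, s₃, x₁.seq (x₂.seq x₃), by omega, ?_⟩
  ext u v
  rw [outputClustering, Setoid.ker_def, Setoid.ker_def, hv₃, hv₃]
  exact encodeLabel_injective.eq_iff

/-- Distances are natural numbers, so one fair clustering suffices for a closest one to exist. -/
theorem exists_isClosestFair {V χ : Type*} {σ : V → χ} {𝓕 : Setoid V} (h : IsFair σ 𝓕)
    (C : Setoid V) : ∃ 𝓖, IsClosestFair σ C 𝓖 := by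
  obtain ⟨𝓖, h𝓖, hmin⟩ := WellFounded.has_min
    (InvImage.wf (dist C) Nat.lt_wfRel.wf) {𝓖 | IsFair σ 𝓖} ⟨𝓕, h⟩
  exact ⟨𝓖, h𝓖, fun 𝓗 h𝓗 => not_lt.1 (hmin 𝓗 h𝓗)⟩

theorem isCloseFair_fairLabel {σ : Fin n → Fin d} (hσ : EqualColorClasses σ) {α : ℝ}
    (hα : ((3 * (d - 1) : ℕ) : ℝ) ≤ α) :
    IsCloseFair α σ (Setoid.ker label) (Setoid.ker (fairLabel σ label)) := by
  have hfair := isFair_fairLabel σ label hσ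
  obtain ⟨𝓖, h𝓖⟩ := exists_isClosestFair hfair (Setoid.ker label)
  refine ⟨hfair, 𝓖, h𝓖, ?_⟩
  have h := dist_fairLabel_le σ label hσ h𝓖.1
  rw [Fintype.card_fin] at h
  calc (dist (Setoid.ker label) (Setoid.ker (fairLabel σ label)) : ℝ)
      ≤ ((3 * (d - 1) : ℕ) : ℝ) * (dist (Setoid.ker label) 𝓖 : ℝ) := by exact_mod_cast h
    _ ≤ _ := by gcongr

end Algorithm

/-! ### Comparing $3(d-1)$ with the required factors -/

section Bounds

theorem three_mul_pred_le_rpow {d : ℕ} (hd : 2 < d) :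
    ((3 * (d - 1) : ℕ) : ℝ) ≤ 3 * (d : ℝ) ^ (1.6 : ℝ) := by
  have h1 : (1 : ℝ) ≤ d := by exact_mod_cast (by omega : 1 ≤ d)
  have h2 : (d : ℝ) ≤ (d : ℝ) ^ (1.6 : ℝ) := by
    simpa using Real.rpow_le_rpow_of_exponent_le h1 (by norm_num : (1 : ℝ) ≤ 1.6)
  have h3 : ((3 * (d - 1) : ℕ) : ℝ) ≤ 3 * d := by exact_mod_cast (by omega)
  linarith

theorem one_le_logb_rpow {d : ℕ} (hd : 2 < d) :
    (1 : ℝ) ≤ (Real.logb 2 (d : ℝ)) ^ (2.81 : ℝ) := by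
  refine Real.one_le_rpow ?_ (by norm_num)
  rw [Real.le_logb_iff_rpow_le (by norm_num) (by exact_mod_cast (by omega))]
  simpa using (by exact_mod_cast hd.le : (2 : ℝ) ≤ d)

/-- Equality holds at exponent 2; afterwards $3(2b-1)\le 9(b-1)$ for $b\ge 2$. -/
theorem three_mul_two_pow_pred_le (k : ℕ) : 3 * (2 ^ (k + 2) - 1) ≤ 3 ^ (k + 2) := by
  induction k with
  | zero => norm_num
  | succ k ih =>
    rw [show k + 1 + 2 = (k + 2) + 1 by ring, pow_succ 2, pow_succ 3]
    have : 2 ^ 2 ≤ 2 ^ (k + 2) := Nat.pow_le_pow_right (by norm_num) (by omega)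
    generalize 2 ^ (k + 2) = b at *
    omega

end Bounds

end FairClustering

theorem mainTheorem6 :
    ∃ (P : FairClustering.Prog) (time : Polynomial ℕ) (K : ℝ), 0 < K ∧
      ∀ (d : ℕ), 2 < d → ∀ (n : ℕ) (σ : Fin n → Fin d), FairClustering.EqualColorClasses σ →
        ∀ (C : Setoid (Fin n)) (label : Fin n → Fin n), Setoid.ker label = C →
          ∃ (t : ℕ) (s : FairClustering.Store),
            FairClustering.Exec P (FairClustering.inputStore σ label) t s ∧
            t ≤ time.eval n ∧
            FairClustering.IsCloseFair
              (K * ((d : ℝ) ^ (1.6 : ℝ) * (Real.logb 2 (d : ℝ)) ^ (2.81 : ℝ))) σ C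
              (FairClustering.outputClustering n s) ∧
            ∀ k : ℕ, d = 2 ^ k →
              FairClustering.IsCloseFair (K * (d : ℝ) ^ (1.6 : ℝ)) σ C
                (FairClustering.outputClustering n s) ∧
              FairClustering.IsCloseFair ((3 : ℝ) ^ k) σ C
                (FairClustering.outputClustering n s) := by
  open FairClustering in
  refine ⟨fairProg, 3 * (.X * (.X * 100 + 100) + 100), 3, by norm_num, ?_⟩
  rintro d hd n σ hσ _ label rfl
  obtain ⟨t, s, hx, ht, hs⟩ := exec_fairProg σ label
  have hd' := three_mul_pred_le_rpow hd
  refine ⟨t, s, hx, ht.trans (by simp), ?_, fun k hk => ⟨?_, ?_⟩⟩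
  all_goals rw [hs]; refine isCloseFair_fairLabel label hσ ?_
  · refine hd'.trans (mul_le_mul_of_nonneg_left ?_ (by norm_num))
    exact le_mul_of_one_le_right (by positivity) (one_le_logb_rpow hd)
  · exact hd'
  -- $2^k>2$ forces $k\ge 2$.
  · obtain ⟨j, rfl⟩ : ∃ j, k = j + 2 := by
      refine Nat.exists_eq_add_of_le' (le_of_not_gt fun h => ?_)
      interval_cases k <;> omega
    rw [hk]
    exact_mod_cast three_mul_two_pow_pred_le j
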